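/- Let $(M,g)$ be a smooth Riemannian manifold of dimension $m\ge 1$ (without boundary, not necessarily connected, compact or complete), and let $f\in C^\infty(M)$ satisfy $\|\operatorname{grad} f\|<1$ on $M$, where $\operatorname{grad}$ and $\|\cdot\|$ are taken with respect to $g$. Then $\tilde g=g-df\otimes df$ is a Riemannian metric on $M$; let $\tilde I_d:(M,\tilde g)\to(M,g)$, $x\mapsto x$, be the identity map. Recall that a smooth map $\varphi:(M,g_1)\to(N,g_2)$ is harmonic if its tension field $\tau(\varphi)=\operatorname{trace}_{g_1}\nabla d\varphi$ vanishes identically. Assume that $\operatorname{Hess}_f=\lambda g$ for some $\lambda\in C^\infty(M)$, where $\operatorname{Hess}_f$ is the Hessian of $f$ with respect to $g$. Then $\tilde I_d$ is harmonic if and only if $\lambda=0$ identically on $M$. -/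

import Mathlib

open Module
open scoped Manifold ContDiff

noncomputable section

/-- Smooth Riemannian metrics on a smooth manifold `M` (without boundary) modelled on `E`. -/
abbrev SmoothMetric (E : Type*) [NormedAddCommGroup E] [NormedSpace ℝ E]
    (M : Type*) [TopologicalSpace M] [ChartedSpace E M] [IsManifold 𝓘(ℝ, E) ∞ M] :=
  Bundle.ContMDiffRiemannianMetric 𝓘(ℝ, E) ∞ E (fun x : M => TangentSpace 𝓘(ℝ, E) x)

namespace RiemHarmonic

section Metric

variable {E : Type*} [NormedAddCommGroup E] [NormedSpace ℝ E] [FiniteDimensional ℝ E]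
  {M : Type*} [TopologicalSpace M] [ChartedSpace E M] [IsManifold 𝓘(ℝ, E) ∞ M]

instance instFiniteDimensionalTangent (x : M) :
    FiniteDimensional ℝ (TangentSpace 𝓘(ℝ, E) x) :=
  inferInstanceAs (FiniteDimensional ℝ E)

instance instT2SpaceTangent (x : M) : T2Space (TangentSpace 𝓘(ℝ, E) x) :=
  inferInstanceAs (T2Space E)

theorem flat_bijective (g : SmoothMetric E M) (x : M) :
    Function.Bijective
      (fun v : TangentSpace 𝓘(ℝ, E) x => (g.inner x v : TangentSpace 𝓘(ℝ, E) x →ₗ[ℝ] ℝ)) := by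
  let L : TangentSpace 𝓘(ℝ, E) x →ₗ[ℝ] Module.Dual ℝ (TangentSpace 𝓘(ℝ, E) x) :=
    { toFun := fun v => (g.inner x v : TangentSpace 𝓘(ℝ, E) x →ₗ[ℝ] ℝ)
      map_add' := by intro v w; ext z; simp
      map_smul' := by intro c w; ext z; simp }
  have hinj : Function.Injective L := by
    rw [injective_iff_map_eq_zero]
    intro v hv
    by_contra hne
    have h1 := g.pos x v hne
    have h2 : g.inner x v v = 0 := LinearMap.congr_fun hv v
    linarith
  exact ⟨hinj, (LinearMap.injective_iff_surjective_of_finrank_eq_finrank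
    (Subspace.dual_finrank_eq).symm).1 hinj⟩

theorem existsUnique_sharp (g : SmoothMetric E M) (x : M)
    (α : TangentSpace 𝓘(ℝ, E) x →L[ℝ] ℝ) :
    ∃! v : TangentSpace 𝓘(ℝ, E) x, ∀ w, g.inner x v w = α w := by
  obtain ⟨v, hv⟩ := (flat_bijective g x).2 (α : TangentSpace 𝓘(ℝ, E) x →ₗ[ℝ] ℝ)
  refine ⟨v, fun w => LinearMap.congr_fun hv w, fun v' hv' => (flat_bijective g x).1 ?_⟩
  ext w
  exact (hv' w).trans (LinearMap.congr_fun hv w).symm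

/-- The vector `α♯` representing the covector `α`: `g (α♯, w) = α w` for all `w`. -/
def sharp (g : SmoothMetric E M) (x : M) (α : TangentSpace 𝓘(ℝ, E) x →L[ℝ] ℝ) :
    TangentSpace 𝓘(ℝ, E) x :=
  (existsUnique_sharp g x α).choose

theorem inner_sharp (g : SmoothMetric E M) (x : M) (α : TangentSpace 𝓘(ℝ, E) x →L[ℝ] ℝ)
    (w : TangentSpace 𝓘(ℝ, E) x) : g.inner x (sharp g x α) w = α w :=
  (existsUnique_sharp g x α).choose_spec.1 w

/-- The gradient of `f` with respect to `g`: `g (grad f, w) = df w`. -/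
def grad (g : SmoothMetric E M) (f : M → ℝ) (x : M) : TangentSpace 𝓘(ℝ, E) x :=
  sharp g x (mvfderiv 𝓘(ℝ, E) f x)

theorem exists_orthonormal_basis (g : SmoothMetric E M) (x : M) :
    ∃ e : Basis (Fin (finrank ℝ E)) ℝ (TangentSpace 𝓘(ℝ, E) x),
      ∀ i j, g.inner x (e i) (e j) = if i = j then 1 else 0 := by
  let c := g.toRiemannianMetric.toCore x
  let : NormedAddCommGroup (TangentSpace 𝓘(ℝ, E) x) := c.toNormedAddCommGroup
  let : InnerProductSpace ℝ (TangentSpace 𝓘(ℝ, E) x) := InnerProductSpace.ofCore c.toCore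
  have hd : finrank ℝ (TangentSpace 𝓘(ℝ, E) x) = finrank ℝ E := rfl
  let b := (stdOrthonormalBasis ℝ (TangentSpace 𝓘(ℝ, E) x)).reindex (finCongr hd)
  exact ⟨b.toBasis, fun i j => by
    rw [OrthonormalBasis.coe_toBasis]
    exact orthonormal_iff_ite.1 b.orthonormal i j⟩

/-- A `g`-orthonormal basis `(e_i)` of the tangent space at `x`. -/
def orthonormalBasis (g : SmoothMetric E M) (x : M) :
    Basis (Fin (finrank ℝ E)) ℝ (TangentSpace 𝓘(ℝ, E) x) :=
  (exists_orthonormal_basis g x).choose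

theorem inner_orthonormalBasis (g : SmoothMetric E M) (x : M) (i j : Fin (finrank ℝ E)) :
    g.inner x (orthonormalBasis g x i) (orthonormalBasis g x j) = if i = j then 1 else 0 :=
  (exists_orthonormal_basis g x).choose_spec i j

/-- The coordinate basis at `p` of the chart around `x`: it sends `(v^i)` to `∑ v^i ∂_i` at `p`. -/
def ofCoords (x p : M) : E →L[ℝ] TangentSpace 𝓘(ℝ, E) p :=
  (trivializationAt E (TangentSpace 𝓘(ℝ, E) : M → Type _) x).symmL ℝ p

/-- Coordinates of tangent vectors at `p` in the chart around `x`. -/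
def toCoords (x p : M) : TangentSpace 𝓘(ℝ, E) p →L[ℝ] E :=
  (trivializationAt E (TangentSpace 𝓘(ℝ, E) : M → Type _) x).continuousLinearMapAt ℝ p

/-- The metric `g` read in the chart around `x` (the matrix `g_ij` as a function of `y`). -/
def chartMetric (g : SmoothMetric E M) (x : M) (y : E) : E →L[ℝ] E →L[ℝ] ℝ :=
  let p := (extChartAt 𝓘(ℝ, E) x).symm y
  (ContinuousLinearMap.precomp ℝ (ofCoords x p)) ∘L (g.inner p) ∘L (ofCoords x p)

/-- The Levi-Civita connection of `g`, through its Christoffel symbols at `x` in the chart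
around `x`: `Γ (u, v) = ∑ Γ^k_ij u^i v^j ∂_k`, that is,
`2 g (Γ (u, v), w) = (∂_u g) (v, w) + (∂_v g) (u, w) - (∂_w g) (u, v)`. -/
def christoffel (g : SmoothMetric E M) (x : M) (u v : TangentSpace 𝓘(ℝ, E) x) :
    TangentSpace 𝓘(ℝ, E) x :=
  let D : E →L[ℝ] E →L[ℝ] E →L[ℝ] ℝ := fderiv ℝ (chartMetric g x) (extChartAt 𝓘(ℝ, E) x x)
  let u' : E := toCoords x x u
  let v' : E := toCoords x x v
  sharp g x (((1 / 2 : ℝ) • (D u' v' + D v' u' - (D.flip u').flip v')) ∘L toCoords x x)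

/-- The Hessian `Hess_f = ∇ df` with respect to `g`; in coordinates,
`∂_i ∂_j f - ∑ Γ^k_ij ∂_k f`. -/
def hessian (g : SmoothMetric E M) (f : M → ℝ) (x : M) (u v : TangentSpace 𝓘(ℝ, E) x) : ℝ :=
  fderiv ℝ (fderiv ℝ (f ∘ (extChartAt 𝓘(ℝ, E) x).symm)) (extChartAt 𝓘(ℝ, E) x x)
      (toCoords x x u) (toCoords x x v)
    - mvfderiv 𝓘(ℝ, E) f x (christoffel g x u v)

end Metric

section Harmonic

variable {E : Type*} [NormedAddCommGroup E] [NormedSpace ℝ E] [FiniteDimensional ℝ E]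
  {M : Type*} [TopologicalSpace M] [ChartedSpace E M] [IsManifold 𝓘(ℝ, E) ∞ M]
  {F : Type*} [NormedAddCommGroup F] [NormedSpace ℝ F] [FiniteDimensional ℝ F]
  {N : Type*} [TopologicalSpace N] [ChartedSpace F N] [IsManifold 𝓘(ℝ, F) ∞ N]

/-- The second fundamental form `∇dφ` of a map `φ : (M, g) → (N, h)`; in coordinates,
`∂_i ∂_j φ^γ + ∑ Γ(h)^γ_αβ ∂_i φ^α ∂_j φ^β - ∑ Γ(g)^k_ij ∂_k φ^γ`. -/
def secondFundamentalForm (g : SmoothMetric E M) (h : SmoothMetric F N) (φ : M → N) (x : M)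
    (u v : TangentSpace 𝓘(ℝ, E) x) : TangentSpace 𝓘(ℝ, F) (φ x) :=
  let dφ : TangentSpace 𝓘(ℝ, E) x →L[ℝ] TangentSpace 𝓘(ℝ, F) (φ x) :=
    mfderiv 𝓘(ℝ, E) 𝓘(ℝ, F) φ x
  ofCoords (φ x) (φ x)
      (fderiv ℝ (fderiv ℝ (writtenInExtChartAt 𝓘(ℝ, E) 𝓘(ℝ, F) x φ)) (extChartAt 𝓘(ℝ, E) x x)
        (toCoords x x u) (toCoords x x v))
    + christoffel h (φ x) (dφ u) (dφ v) - dφ (christoffel g x u v)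

/-- The tension field `τ(φ) = trace_g ∇dφ = ∑ ∇dφ (e_i, e_i)`, for an orthonormal basis `(e_i)`. -/
def tensionField (g : SmoothMetric E M) (h : SmoothMetric F N) (φ : M → N) (x : M) :
    TangentSpace 𝓘(ℝ, F) (φ x) :=
  ∑ i, secondFundamentalForm g h φ x (orthonormalBasis g x i) (orthonormalBasis g x i)

/-- A smooth map `φ : (M, g) → (N, h)` is harmonic if its tension field vanishes. -/
def IsHarmonicMap (g : SmoothMetric E M) (h : SmoothMetric F N) (φ : M → N) : Prop :=
  ContMDiff 𝓘(ℝ, E) 𝓘(ℝ, F) ∞ φ ∧ ∀ x, tensionField g h φ x = 0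

end Harmonic

section Deformation

variable {E : Type*} [NormedAddCommGroup E] [NormedSpace ℝ E] [FiniteDimensional ℝ E]
  {M : Type*} [TopologicalSpace M] [ChartedSpace E M] [IsManifold 𝓘(ℝ, E) ∞ M]

/-- The bilinear form `df ⊗ df` at `x`. -/
def dfSq (f : M → ℝ) (x : M) :
    TangentSpace 𝓘(ℝ, E) x →L[ℝ] TangentSpace 𝓘(ℝ, E) x →L[ℝ] ℝ :=
  (mvfderiv 𝓘(ℝ, E) f x).smulRight (mvfderiv 𝓘(ℝ, E) f x)

theorem dfSq_apply (f : M → ℝ) (x : M) (v w : TangentSpace 𝓘(ℝ, E) x) :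
    dfSq f x v w = mvfderiv 𝓘(ℝ, E) f x v * mvfderiv 𝓘(ℝ, E) f x w := by
  simp [dfSq]

theorem sq_mvfderiv_le (g : SmoothMetric E M) (f : M → ℝ) (x : M)
    (v : TangentSpace 𝓘(ℝ, E) x) :
    (mvfderiv 𝓘(ℝ, E) f x v) ^ 2 ≤ g.inner x (grad g f x) (grad g f x) * g.inner x v v := by
  have h0 : ∀ w : TangentSpace 𝓘(ℝ, E) x, 0 ≤ g.inner x w w := by
    intro w
    rcases eq_or_ne w 0 with rfl | hw
    · simp
    · exact (g.pos x w hw).le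
  have hg : ∀ w, mvfderiv 𝓘(ℝ, E) f x w = g.inner x (grad g f x) w :=
    fun w => (inner_sharp g x _ w).symm
  have hdisc : ∀ t : ℝ, 0 ≤ g.inner x v v * (t * t)
      + (2 * g.inner x (grad g f x) v) * t + g.inner x (grad g f x) (grad g f x) := by
    intro t
    have h := h0 (grad g f x + t • v)
    simp only [map_add, map_smul, add_apply, smul_apply,
      smul_eq_mul, g.symm x v (grad g f x)] at h
    nlinarith [h]
  have := discrim_le_zero hdisc
  rw [discrim] at this
  rw [hg]
  nlinarith [this]

theorem contMDiff_dfSq {f : M → ℝ} (hf : ContMDiff 𝓘(ℝ, E) 𝓘(ℝ, ℝ) ∞ f) :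
    ContMDiff 𝓘(ℝ, E) (𝓘(ℝ, E).prod 𝓘(ℝ, E →L[ℝ] E →L[ℝ] ℝ)) ∞
      (fun x : M => Bundle.TotalSpace.mk' (E →L[ℝ] E →L[ℝ] ℝ)
        (E := fun x : M => TangentSpace 𝓘(ℝ, E) x →L[ℝ] TangentSpace 𝓘(ℝ, E) x →L[ℝ] ℝ)
        x (dfSq f x)) := by
  intro x₀
  have h1 : IsManifold 𝓘(ℝ, E) 1 M := IsManifold.of_le (n := ∞) (by norm_cast)
  have hd := (hf x₀).mfderiv_const (m := ∞) (by norm_num)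
  have hd' : ContMDiffAt 𝓘(ℝ, E) 𝓘(ℝ, E →L[ℝ] ℝ) ∞
      (fun x => (mvfderiv 𝓘(ℝ, E) f x) ∘L (ofCoords x₀ x)) x₀ := by
    refine hd.congr_of_eventuallyEq (Filter.Eventually.of_forall fun x => ?_)
    ext v
    simp [inTangentCoordinates, ContinuousLinearMap.inCoordinates, ofCoords, mvfderiv]
    rfl
  rw [contMDiffAt_hom_bundle]
  refine ⟨contMDiffAt_id, ?_⟩
  have hq : ContMDiffAt 𝓘(ℝ, E) 𝓘(ℝ, E →L[ℝ] E →L[ℝ] ℝ) ∞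
      (fun x => ContinuousLinearMap.smulRightL ℝ E (E →L[ℝ] ℝ)
        ((mvfderiv 𝓘(ℝ, E) f x) ∘L (ofCoords x₀ x))
        ((mvfderiv 𝓘(ℝ, E) f x) ∘L (ofCoords x₀ x))) x₀ :=
    (contMDiffAt_const.clm_apply hd').clm_apply hd'
  refine hq.congr_of_eventuallyEq ?_
  filter_upwards [(chartAt E x₀).open_source.mem_nhds (mem_chart_source E x₀)] with x hx
  ext v w
  simp [ContinuousLinearMap.inCoordinates, ofCoords, dfSq]
  left
  rw [Bundle.Trivialization.coe_linearMapAt_of_mem _ (by simpa using hx)]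
  simp [hom_trivializationAt_apply, ContinuousLinearMap.inCoordinates]

/-- The metric `g - df ⊗ df`, for a smooth function `f` with `‖grad f‖ < 1`. -/
def deformedMetric (g : SmoothMetric E M) (f : M → ℝ) (hf : ContMDiff 𝓘(ℝ, E) 𝓘(ℝ, ℝ) ∞ f)
    (hgrad : ∀ x, g.inner x (grad g f x) (grad g f x) < 1) : SmoothMetric E M where
  inner x := g.inner x - dfSq f x
  symm x v w := by
    simp only [sub_apply, dfSq_apply, g.symm x v w, mul_comm]
  pos x v hv := by
    simp only [sub_apply, dfSq_apply]
    nlinarith [g.pos x v hv, hgrad x, sq_mvfderiv_le g f x v,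
      mul_pos (sub_pos.2 (hgrad x)) (g.pos x v hv)]
  isVonNBounded x := by
    have hs : 0 < 1 - g.inner x (grad g f x) (grad g f x) := sub_pos.2 (hgrad x)
    set c := Real.sqrt (1 - g.inner x (grad g f x) (grad g f x)) with hc
    have hc0 : 0 < c := Real.sqrt_pos.2 hs
    have hc2 : c * c = 1 - g.inner x (grad g f x) (grad g f x) := Real.mul_self_sqrt hs.le
    refine ((g.isVonNBounded x).image
      (c⁻¹ • ContinuousLinearMap.id ℝ (TangentSpace 𝓘(ℝ, E) x))).subset ?_
    intro v hv
    refine ⟨c • v, ?_, by simp [smul_smul, hc0.ne']⟩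
    simp only [Set.mem_ofPred_eq, sub_apply, dfSq_apply] at hv
    simp only [Set.mem_ofPred_eq, map_smul, smul_apply, smul_eq_mul]
    rw [← mul_assoc, hc2]
    nlinarith [sq_mvfderiv_le g f x v]
  contMDiff := g.contMDiff.sub_section (contMDiff_dfSq hf)

end Deformation

end RiemHarmonic

end

/-! Write g' = g - df ⊗ df and s = ‖grad f‖². In a chart, the corrections that df ⊗ df brings to the
Koszul formula cancel by symmetry of ∂²f, except for -∂²f(u, v) df(w). Solving for the Christoffel
symbols gives ∇d(id) = Hess_f / (1 - s) • grad f (`secondFundamentalForm_deformedMetric_id`), so the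
tension field is tr_{g'} Hess_f / (1 - s) • grad f.

If Hess_f = λ g, that trace is λ times a positive number, so harmonicity means λ grad f = 0. Where λ
≠ 0, an open condition, grad f vanishes on a neighbourhood, hence so does Hess_f = λ g, forcing λ =
0: a contradiction. -/

namespace RiemHarmonic

open Filter Topology

/-! ### Differentials and metrics in a chart -/

section Coordinates

variable {E : Type*} [NormedAddCommGroup E] [NormedSpace ℝ E]
  {M : Type*} [TopologicalSpace M] [ChartedSpace E M] [IsManifold 𝓘(ℝ, E) ∞ M]

theorem ofCoords_toCoords (x : M) (v : TangentSpace 𝓘(ℝ, E) x) :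
    ofCoords x x (toCoords x x v) = v :=
  Bundle.Trivialization.symmL_continuousLinearMapAt _
    (FiberBundle.mem_baseSet_trivializationAt' x) v

/-- The differential of `f` in the coordinate frame of the chart around `x`. -/
theorem mvfderiv_ofCoords {f : M → ℝ} (hf : ContMDiff 𝓘(ℝ, E) 𝓘(ℝ, ℝ) ∞ f) (x : M) {y : E}
    (hy : y ∈ (extChartAt 𝓘(ℝ, E) x).target) (u : E) :
    mvfderiv 𝓘(ℝ, E) f ((extChartAt 𝓘(ℝ, E) x).symm y)
        (ofCoords x ((extChartAt 𝓘(ℝ, E) x).symm y) u)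
      = fderiv ℝ (f ∘ (extChartAt 𝓘(ℝ, E) x).symm) y u := by
  set e := extChartAt 𝓘(ℝ, E) x
  have hp : e.symm y ∈ (chartAt E x).source := by
    simpa [e] using e.map_target hy
  have h1 : IsManifold 𝓘(ℝ, E) 1 M := IsManifold.of_le (n := ∞) (by norm_cast)
  have hs : MDifferentiableAt 𝓘(ℝ, E) 𝓘(ℝ, E) e.symm y := by
    have := mdifferentiableWithinAt_extChartAt_symm (I := 𝓘(ℝ, E)) (x := x) hy
    rwa [modelWithCornersSelf_coe, Set.range_id, mdifferentiableWithinAt_univ] at this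
  have hfd : MDifferentiableAt 𝓘(ℝ, E) 𝓘(ℝ, ℝ) f (e.symm y) :=
    (hf _).mdifferentiableAt (by simp)
  have hc := mfderiv_comp y hfd hs
  rw [mfderiv_eq_fderiv] at hc
  rw [hc]
  -- The coordinate frame is the differential of the inverse chart, so the claim is the chain rule.
  have ho : ofCoords x (e.symm y) u = mfderiv 𝓘(ℝ, E) 𝓘(ℝ, E) e.symm y u := by
    have h := TangentBundle.symmL_trivializationAt (I := 𝓘(ℝ, E)) hp
    unfold ofCoords
    rw [h]
    simp only [modelWithCornersSelf_coe, Set.range_id, mfderivWithin_univ]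
    exact congrArg (fun z => mfderiv 𝓘(ℝ, E) 𝓘(ℝ, E) e.symm z u) (e.right_inv hy)
  rw [ho]
  rfl

theorem contDiffAt_comp_chart_symm {f : M → ℝ} (hf : ContMDiff 𝓘(ℝ, E) 𝓘(ℝ, ℝ) ∞ f) (x : M)
    {y : E} (hy : y ∈ (extChartAt 𝓘(ℝ, E) x).target) :
    ContDiffAt ℝ ∞ (f ∘ (extChartAt 𝓘(ℝ, E) x).symm) y := by
  have h := (contMDiffOn_extChartAt_symm (I := 𝓘(ℝ, E)) (n := ∞) x).contMDiffAt
    ((isOpen_extChartAt_target x).mem_nhds hy)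
  exact (hf.contMDiffAt.comp y h).contDiffAt

theorem mvfderiv_eq_fderiv_toCoords {f : M → ℝ} (hf : ContMDiff 𝓘(ℝ, E) 𝓘(ℝ, ℝ) ∞ f) (x : M)
    (v : TangentSpace 𝓘(ℝ, E) x) :
    mvfderiv 𝓘(ℝ, E) f x v = fderiv ℝ (f ∘ (extChartAt 𝓘(ℝ, E) x).symm)
      (extChartAt 𝓘(ℝ, E) x x) (toCoords x x v) := by
  have h := mvfderiv_ofCoords hf x (mem_extChartAt_target (I := 𝓘(ℝ, E)) x) (toCoords x x v)
  rw [extChartAt_to_inv x, ofCoords_toCoords] at h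
  exact h

theorem chartMetric_apply (g : SmoothMetric E M) (x : M) (y u v : E) :
    chartMetric g x y u v = g.inner ((extChartAt 𝓘(ℝ, E) x).symm y)
      (ofCoords x ((extChartAt 𝓘(ℝ, E) x).symm y) u)
      (ofCoords x ((extChartAt 𝓘(ℝ, E) x).symm y) v) :=
  rfl

/-- Near the base point `chartMetric` is the trivialized bundle section composed with the inverse
chart, so it inherits the smoothness of g. Without this its `fderiv` could be the default value 0.
-/
theorem differentiableAt_chartMetric (g : SmoothMetric E M) (x : M) :
    DifferentiableAt ℝ (chartMetric g x) (extChartAt 𝓘(ℝ, E) x x) := by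
  have hg := (contMDiffAt_hom_bundle _).1 (g.contMDiff x)
  have h2 := hg.2
  have hs := (contMDiffOn_extChartAt_symm (I := 𝓘(ℝ, E)) (n := ∞) x).contMDiffAt
    (extChartAt_target_mem_nhds (I := 𝓘(ℝ, E)) x)
  have h3 : ContMDiffAt 𝓘(ℝ, E) 𝓘(ℝ, E →L[ℝ] E →L[ℝ] ℝ) ∞ _ (extChartAt 𝓘(ℝ, E) x x) :=
    ContMDiffAt.comp_of_eq h2 hs (extChartAt_to_inv x)
  refine (h3.contDiffAt.differentiableAt (by simp)).congr_of_eventuallyEq ?_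
  filter_upwards [extChartAt_target_mem_nhds (I := 𝓘(ℝ, E)) x] with y hy
  have hp : (extChartAt 𝓘(ℝ, E) x).symm y ∈ (chartAt E x).source := by
    simpa using (extChartAt 𝓘(ℝ, E) x).map_target hy
  ext v w
  rw [chartMetric_apply]
  simp [ContinuousLinearMap.inCoordinates, ofCoords]
  rw [Bundle.Trivialization.coe_linearMapAt_of_mem _ (by simpa using hp)]
  simp [hom_trivializationAt_apply, ContinuousLinearMap.inCoordinates]
  rfl

theorem hasFDerivAt_chartMetric_apply (g : SmoothMetric E M) (x : M) (b c : E) :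
    HasFDerivAt (fun y => chartMetric g x y b c)
      (((fderiv ℝ (chartMetric g x) (extChartAt 𝓘(ℝ, E) x x)).flip b).flip c)
      (extChartAt 𝓘(ℝ, E) x x) := by
  have h := ((differentiableAt_chartMetric g x).hasFDerivAt.clm_apply
    (hasFDerivAt_const b _)).clm_apply (hasFDerivAt_const c _)
  refine h.congr_fderiv ?_
  ext a
  simp

end Coordinates

/-! ### First derivatives of the deformed metric -/

section DeformedMetric

variable {E : Type*} [NormedAddCommGroup E] [NormedSpace ℝ E] [FiniteDimensional ℝ E]
  {M : Type*} [TopologicalSpace M] [ChartedSpace E M] [IsManifold 𝓘(ℝ, E) ∞ M]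

theorem deformedMetric_inner_apply (g : SmoothMetric E M) {f : M → ℝ}
    (hf : ContMDiff 𝓘(ℝ, E) 𝓘(ℝ, ℝ) ∞ f)
    (hgrad : ∀ x, g.inner x (grad g f x) (grad g f x) < 1) (x : M)
    (v w : TangentSpace 𝓘(ℝ, E) x) :
    (deformedMetric g f hf hgrad).inner x v w =
      g.inner x v w - mvfderiv 𝓘(ℝ, E) f x v * mvfderiv 𝓘(ℝ, E) f x w := by
  rw [← dfSq_apply]
  rfl

theorem chartMetric_deformedMetric_apply (g : SmoothMetric E M) {f : M → ℝ}
    (hf : ContMDiff 𝓘(ℝ, E) 𝓘(ℝ, ℝ) ∞ f)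
    (hgrad : ∀ x, g.inner x (grad g f x) (grad g f x) < 1) (x : M) {y : E}
    (hy : y ∈ (extChartAt 𝓘(ℝ, E) x).target) (u v : E) :
    chartMetric (deformedMetric g f hf hgrad) x y u v = chartMetric g x y u v -
      fderiv ℝ (f ∘ (extChartAt 𝓘(ℝ, E) x).symm) y u *
        fderiv ℝ (f ∘ (extChartAt 𝓘(ℝ, E) x).symm) y v := by
  rw [chartMetric_apply, chartMetric_apply, deformedMetric_inner_apply,
    mvfderiv_ofCoords hf x hy, mvfderiv_ofCoords hf x hy]

theorem fderiv_chartMetric_deformedMetric (g : SmoothMetric E M) {f : M → ℝ}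
    (hf : ContMDiff 𝓘(ℝ, E) 𝓘(ℝ, ℝ) ∞ f)
    (hgrad : ∀ x, g.inner x (grad g f x) (grad g f x) < 1) (x : M) (a b c : E) :
    let F := f ∘ (extChartAt 𝓘(ℝ, E) x).symm
    let y := extChartAt 𝓘(ℝ, E) x x
    fderiv ℝ (chartMetric (deformedMetric g f hf hgrad) x) y a b c =
      fderiv ℝ (chartMetric g x) y a b c
        - (fderiv ℝ (fderiv ℝ F) y a b * fderiv ℝ F y c
          + fderiv ℝ F y b * fderiv ℝ (fderiv ℝ F) y a c) := by
  intro F y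
  have hF : DifferentiableAt ℝ (fderiv ℝ F) y :=
    ((contDiffAt_comp_chart_symm hf x (mem_extChartAt_target x)).fderiv_right
      (m := 1) (by norm_cast)).differentiableAt (by simp)
  -- The entrywise formula holds only on the chart target, which suffices for a derivative at the
  -- base point.
  have he : (fun z => chartMetric (deformedMetric g f hf hgrad) x z b c) =ᶠ[𝓝 y]
      fun z => chartMetric g x z b c - fderiv ℝ F z b * fderiv ℝ F z c := by
    filter_upwards [extChartAt_target_mem_nhds (I := 𝓘(ℝ, E)) x] with z hz
    exact chartMetric_deformedMetric_apply g hf hgrad x hz b c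
  have hP : ∀ d : E, HasFDerivAt (fun z => fderiv ℝ F z d) ((fderiv ℝ (fderiv ℝ F) y).flip d) y :=
    fun d => (hF.hasFDerivAt.clm_apply (hasFDerivAt_const d y)).congr_fderiv (by ext a; simp)
  have h1 := hasFDerivAt_chartMetric_apply (deformedMetric g f hf hgrad) x b c
  have h2 := ((hasFDerivAt_chartMetric_apply g x b c).sub
    ((hP b).mul (hP c))).congr_of_eventuallyEq he
  have h3 := DFunLike.congr_fun (h1.unique h2) a
  simp only [ContinuousLinearMap.flip_apply, sub_apply, add_apply, smul_apply, smul_eq_mul] at h3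
  rw [h3]
  ring

end DeformedMetric

/-! ### Comparison of the two Levi-Civita connections -/

section SecondFundamentalForm

variable {E : Type*} [NormedAddCommGroup E] [NormedSpace ℝ E] [FiniteDimensional ℝ E]
  {M : Type*} [TopologicalSpace M] [ChartedSpace E M] [IsManifold 𝓘(ℝ, E) ∞ M]

theorem inner_grad (g : SmoothMetric E M) (f : M → ℝ) (x : M) (w : TangentSpace 𝓘(ℝ, E) x) :
    g.inner x (grad g f x) w = mvfderiv 𝓘(ℝ, E) f x w :=
  inner_sharp g x _ w

theorem eq_of_inner_eq (g : SmoothMetric E M) (x : M) {v v' : TangentSpace 𝓘(ℝ, E) x}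
    (h : ∀ w, g.inner x v w = g.inner x v' w) : v = v' :=
  (flat_bijective g x).1 (LinearMap.ext h)

theorem inner_christoffel (g : SmoothMetric E M) (x : M) (u v w : TangentSpace 𝓘(ℝ, E) x) :
    let D := fderiv ℝ (chartMetric g x) (extChartAt 𝓘(ℝ, E) x x)
    let a : E := toCoords x x u
    let b : E := toCoords x x v
    let c : E := toCoords x x w
    g.inner x (christoffel g x u v) w = 1 / 2 * (D a b c + D b a c - D c a b) := by
  intro D a b c
  exact inner_sharp g x _ w

/-- The Levi-Civita connections of `g - df ⊗ df` and `g` compared. -/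
theorem inner_christoffel_deformedMetric (g : SmoothMetric E M) {f : M → ℝ}
    (hf : ContMDiff 𝓘(ℝ, E) 𝓘(ℝ, ℝ) ∞ f)
    (hgrad : ∀ x, g.inner x (grad g f x) (grad g f x) < 1) (x : M)
    (u v w : TangentSpace 𝓘(ℝ, E) x) :
    (deformedMetric g f hf hgrad).inner x (christoffel (deformedMetric g f hf hgrad) x u v) w =
      g.inner x (christoffel g x u v) w -
        fderiv ℝ (fderiv ℝ (f ∘ (extChartAt 𝓘(ℝ, E) x).symm)) (extChartAt 𝓘(ℝ, E) x x)
          (toCoords x x u) (toCoords x x v) * mvfderiv 𝓘(ℝ, E) f x w := by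
  have hsymm : IsSymmSndFDerivAt ℝ (f ∘ (extChartAt 𝓘(ℝ, E) x).symm) (extChartAt 𝓘(ℝ, E) x x) :=
    (contDiffAt_comp_chart_symm hf x (mem_extChartAt_target x)).isSymmSndFDerivAt
      (by rw [minSmoothness_of_isRCLikeNormedField]; exact WithTop.coe_le_coe.2 le_top)
  rw [inner_christoffel, inner_christoffel, mvfderiv_eq_fderiv_toCoords hf x w]
  simp only [fderiv_chartMetric_deformedMetric]
  -- Once the second derivatives are symmetrized, four of the six correction terms cancel and the
  -- other two coincide, absorbing the factor 1/2.
  rw [hsymm.eq (toCoords x x v) (toCoords x x u), hsymm.eq (toCoords x x w) (toCoords x x u),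
    hsymm.eq (toCoords x x w) (toCoords x x v)]
  ring

/-- The identity reads as the identity in the chart, so its second derivative drops out. -/
theorem secondFundamentalForm_id (g h : SmoothMetric E M) (x : M)
    (u v : TangentSpace 𝓘(ℝ, E) x) :
    secondFundamentalForm g h (id : M → M) x u v =
      (christoffel h x u v - christoffel g x u v : TangentSpace 𝓘(ℝ, E) x) := by
  have he : writtenInExtChartAt 𝓘(ℝ, E) 𝓘(ℝ, E) x (id : M → M)
      =ᶠ[𝓝 (extChartAt 𝓘(ℝ, E) x x)] id := by
    filter_upwards [extChartAt_target_mem_nhds (I := 𝓘(ℝ, E)) x] with y hy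
    exact (extChartAt 𝓘(ℝ, E) x).right_inv hy
  have h2 : fderiv ℝ (fderiv ℝ (writtenInExtChartAt 𝓘(ℝ, E) 𝓘(ℝ, E) x (id : M → M)))
      (extChartAt 𝓘(ℝ, E) x x) = 0 := by
    have hid : fderiv ℝ (id : E → E) = fun _ => ContinuousLinearMap.id ℝ E :=
      funext fun _ => fderiv_id
    rw [he.fderiv.fderiv_eq, hid, fderiv_const_apply]
  unfold secondFundamentalForm
  rw [h2, mfderiv_id]
  simp only [zero_apply, map_zero, zero_add]
  rfl

/-- The second fundamental form of the identity `(M, g - df ⊗ df) → (M, g)` is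
`Hess_f / (1 - ‖grad f‖²) • grad f`. -/
theorem secondFundamentalForm_deformedMetric_id (g : SmoothMetric E M) {f : M → ℝ}
    (hf : ContMDiff 𝓘(ℝ, E) 𝓘(ℝ, ℝ) ∞ f)
    (hgrad : ∀ x, g.inner x (grad g f x) (grad g f x) < 1) (x : M)
    (u v : TangentSpace 𝓘(ℝ, E) x) :
    secondFundamentalForm (deformedMetric g f hf hgrad) g (id : M → M) x u v =
      (hessian g f x u v / (1 - g.inner x (grad g f x) (grad g f x))) • grad g f x := by
  rw [secondFundamentalForm_id]
  have hs : 1 - g.inner x (grad g f x) (grad g f x) ≠ 0 := (sub_pos.2 (hgrad x)).ne'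
  have key := fun w => inner_christoffel_deformedMetric g hf hgrad x u v w
  simp only [deformedMetric_inner_apply] at key
  set G := christoffel (deformedMetric g f hf hgrad) x u v
  -- The relation `key` contains the unknown number df(G); testing it against w = grad f determines
  -- that number, as 1 - s ≠ 0.
  have hG : mvfderiv 𝓘(ℝ, E) f x G * (1 - g.inner x (grad g f x) (grad g f x)) =
      mvfderiv 𝓘(ℝ, E) f x (christoffel g x u v) -
        fderiv ℝ (fderiv ℝ (f ∘ (extChartAt 𝓘(ℝ, E) x).symm)) (extChartAt 𝓘(ℝ, E) x x)
          (toCoords x x u) (toCoords x x v) * g.inner x (grad g f x) (grad g f x) := by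
    have h := key (grad g f x)
    rw [g.symm x G, g.symm x (christoffel g x u v), ← inner_grad g f x (grad g f x)] at h
    rw [inner_grad g f x G, inner_grad g f x (christoffel g x u v)] at h
    linarith
  refine eq_of_inner_eq g x fun w => ?_
  simp only [map_sub, map_smul, sub_apply, smul_apply, smul_eq_mul, inner_grad g f x w]
  rw [hessian, div_mul_eq_mul_div, eq_div_iff hs]
  linear_combination (-(1 - g.inner x (grad g f x) (grad g f x))) * key w
    - mvfderiv 𝓘(ℝ, E) f x w * hG

end SecondFundamentalForm

/-! ### Tension field and the vanishing of λ -/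

section Harmonicity

variable {E : Type*} [NormedAddCommGroup E] [NormedSpace ℝ E] [FiniteDimensional ℝ E]
  {M : Type*} [TopologicalSpace M] [ChartedSpace E M] [IsManifold 𝓘(ℝ, E) ∞ M]

/-- The tension field of the identity `(M, g - df ⊗ df) → (M, g)`: the trace of `Hess_f` is taken
with respect to the deformed metric. -/
theorem tensionField_deformedMetric_id (g : SmoothMetric E M) {f : M → ℝ}
    (hf : ContMDiff 𝓘(ℝ, E) 𝓘(ℝ, ℝ) ∞ f)
    (hgrad : ∀ x, g.inner x (grad g f x) (grad g f x) < 1) (x : M) :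
    tensionField (deformedMetric g f hf hgrad) g (id : M → M) x =
      ((∑ i, hessian g f x (orthonormalBasis (deformedMetric g f hf hgrad) x i)
          (orthonormalBasis (deformedMetric g f hf hgrad) x i)) /
        (1 - g.inner x (grad g f x) (grad g f x))) • grad g f x := by
  rw [Finset.sum_div, Finset.sum_smul]
  exact Finset.sum_congr rfl fun i _ => secondFundamentalForm_deformedMetric_id g hf hgrad x _ _

/-- The basis is orthonormal for the deformed metric, not for g, so the sum need not be the
dimension; positivity only needs nonzero basis vectors and at least one of them. -/
theorem trace_inner_deformedMetric_pos (hdim : 1 ≤ finrank ℝ E) (g : SmoothMetric E M)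
    {f : M → ℝ} (hf : ContMDiff 𝓘(ℝ, E) 𝓘(ℝ, ℝ) ∞ f)
    (hgrad : ∀ x, g.inner x (grad g f x) (grad g f x) < 1) (x : M) :
    0 < ∑ i, g.inner x (orthonormalBasis (deformedMetric g f hf hgrad) x i)
      (orthonormalBasis (deformedMetric g f hf hgrad) x i) :=
  have : NeZero (finrank ℝ E) := ⟨by omega⟩
  Finset.sum_pos (fun i _ => g.pos x _ (Basis.ne_zero _ i)) Finset.univ_nonempty

/-- Vanishing at x alone kills only the Christoffel term; the second derivative in the chart needs
df = 0 on a neighbourhood. -/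
theorem hessian_eq_zero_of_eventually_grad_eq_zero (g : SmoothMetric E M) {f : M → ℝ}
    (hf : ContMDiff 𝓘(ℝ, E) 𝓘(ℝ, ℝ) ∞ f) {x : M} (h : ∀ᶠ p in 𝓝 x, grad g f p = 0)
    (u v : TangentSpace 𝓘(ℝ, E) x) : hessian g f x u v = 0 := by
  have hd : ∀ p, grad g f p = 0 → ∀ w, mvfderiv 𝓘(ℝ, E) f p w = 0 := by
    intro p hp w
    rw [← inner_grad g, hp, map_zero, zero_apply]
  have hc : ContinuousAt (extChartAt 𝓘(ℝ, E) x).symm (extChartAt 𝓘(ℝ, E) x x) :=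
    continuousAt_extChartAt_symm x
  have hev : fderiv ℝ (f ∘ (extChartAt 𝓘(ℝ, E) x).symm)
      =ᶠ[𝓝 (extChartAt 𝓘(ℝ, E) x x)] fun _ => 0 := by
    have h' := hc.eventually (p := fun p => grad g f p = 0) (by rwa [extChartAt_to_inv])
    filter_upwards [h', extChartAt_target_mem_nhds (I := 𝓘(ℝ, E)) x] with y hy hyt
    ext w
    rw [← mvfderiv_ofCoords hf x hyt, hd _ hy, zero_apply]
  rw [hessian, hev.fderiv_eq, fderiv_const_apply, hd x h.self_of_nhds]
  simp

end Harmonicity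

end RiemHarmonic

open RiemHarmonic in
theorem mainTheorem5
    {E : Type*} [NormedAddCommGroup E] [NormedSpace ℝ E] [FiniteDimensional ℝ E]
    (hdim : 1 ≤ Module.finrank ℝ E)
    {M : Type*} [TopologicalSpace M] [T2Space M] [SecondCountableTopology M]
    [ChartedSpace E M] [IsManifold 𝓘(ℝ, E) ∞ M]
    (g : SmoothMetric E M)
    (f : M → ℝ) (hf : ContMDiff 𝓘(ℝ, E) 𝓘(ℝ, ℝ) ∞ f)
    (hgrad : ∀ x, g.inner x (RiemHarmonic.grad g f x) (RiemHarmonic.grad g f x) < 1)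
    (lam : M → ℝ) (hlam : ContMDiff 𝓘(ℝ, E) 𝓘(ℝ, ℝ) ∞ lam)
    (hHess : ∀ (x : M) (u v : TangentSpace 𝓘(ℝ, E) x),
      RiemHarmonic.hessian g f x u v = lam x * g.inner x u v) :
    RiemHarmonic.IsHarmonicMap (RiemHarmonic.deformedMetric g f hf hgrad) g (id : M → M) ↔
      ∀ x, lam x = 0 := by
  constructor
  · rintro ⟨-, hτ⟩ x
    by_contra hx
    have hgrad0 : ∀ p, lam p ≠ 0 → grad g f p = 0 := by
      intro p hp
      have h : _ • grad g f p = 0 :=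
        (tensionField_deformedMetric_id g hf hgrad p).symm.trans (hτ p)
      refine (smul_eq_zero.1 h).resolve_left (div_ne_zero ?_ (sub_pos.2 (hgrad p)).ne')
      simp only [hHess, ← Finset.mul_sum]
      exact mul_ne_zero hp (trace_inner_deformedMetric_pos hdim g hf hgrad p).ne'
    -- Continuity of λ keeps it nonzero near x, so grad f vanishes there.
    have h0 := hessian_eq_zero_of_eventually_grad_eq_zero g hf
      ((hlam.continuous.continuousAt.eventually_ne hx).mono hgrad0)
    -- Tracing Hess_f = λ g at x, where Hess_f = 0, gives λ times a positive sum equal to 0.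
    have hsum := trace_inner_deformedMetric_pos hdim g hf hgrad x
    refine mul_ne_zero hx hsum.ne' ?_
    rw [Finset.mul_sum]
    exact Finset.sum_eq_zero fun i _ => (hHess x _ _).symm.trans (h0 _ _)
  · intro h
    refine ⟨contMDiff_id, fun x => (tensionField_deformedMetric_id g hf hgrad x).trans ?_⟩
    simp only [hHess, h x, zero_mul, Finset.sum_const_zero, zero_div, zero_smul]
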